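/- **Proposition (Analogue of Hölder's Theorem for the function $\omega$).** Let $\mathbb{F}_q$ be a finite field with $q$ elements, $A=\mathbb{F}_q[\theta]$, $K=\mathbb{F}_q(\theta)$, let $K_\infty$ be the completion of $K$ at the infinity place and $\mathbb{C}_\infty$ the completion of an algebraic closure of $K_\infty$. Let $\mathbb{T}$ be the Tate algebra of the formal series $\sum_{n\ge 0} f_nt^n$ with $f_n\in\mathbb{C}_\infty$, $f_n\to 0$, with the Gauss norm $\sup_n|f_n|$, let $\tau$ be the endomorphism $\sum f_nt^n\mapsto\sum f_n^qt^n$ of $\mathbb{T}$, and let $\mathcal{D}_n$ be the divided derivatives in $t$, that is, the operators $\mathcal{D}_n(\sum_m f_mt^m)=\sum_{m\ge n}\binom{m}{n}f_mt^{m-n}$. Let $d_n$ be the product of the monic polynomials of degree $n$ in $A$ and let $\exp_C(f)=\sum_{n\geq 0}d_n^{-1}\tau^n(f)$, for $f\in\mathbb{T}$, be the Carlitz exponential. Let $\widetilde\pi\in\mathbb{C}_\infty^\times$ be a generator of the kernel of $\exp_C$ on $\mathbb{C}_\infty$, so that this kernel is $\widetilde\pi A$. Put $f_i=\widetilde\pi/(\theta-t)^{i+1}\in\mathbb{T}$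 for $i\ge 0$ and $\omega=\exp_C(f_0)$. Then: 1. For all $i\ge 0$, the series $\exp_C(f_i)$ converges in $\mathbb{T}$, and $\exp_C(f_i)=\mathcal{D}_i(\omega)$. 2. The functions $X_i=\mathcal{D}_i(\omega)$ satisfy $\tau(X_i)=(t-\theta)X_i+X_{i-1}$ for all $i\ge 0$, where $X_{-1}:=0$. 3. The functions $\mathcal{D}_i(\omega)$, $i\ge 0$, are algebraically independent over $K(t)$. More precisely, for every $n\ge 0$, let $\mathcal{L}_n=K(t)(\mathcal{D}_i(\omega):0\le i\le n)_\tau$ be the smallest $\tau$-stable field that contains $K(t)$ and $\mathcal{D}_0(\omega),\ldots,\mathcal{D}_n(\omega)$. Then $\operatorname{transf}\deg_{K(t)}\mathcal{L}_n=0$ and $\operatorname{tr}\deg_{K(t)}\mathcal{L}_n=n+1$. Here the transformal degree of $\mathcal{L}_n$ over $K(t)$ is the largest cardinality of a subset $S\subseteq\mathcal{L}_n$ such that the elements $\tau^k(x)$, $x\in S$, $k\ge 0$, are algebraically independent over $K(t)$. Part 3 holds with $\mathcal{L}_n$ taken in the fraction field of $\mathbb{T}$, as well as in the field $\mathbb{K}$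 of the generalised series $\sum_{i\in\mathcal{I}}c_i\theta^{-i}$ ($\mathcal{I}\subset\mathbb{Q}$ well-ordered, $c_i\in\mathbb{F}_q^{ac}(t)$) with the endomorphism $\tau(\sum c_i\theta^{-i})=\sum\tau(c_i)\theta^{-qi}$, where $\tau$ acts on $\mathbb{F}_q^{ac}(t)$ by $c\mapsto c^q$ on $\mathbb{F}_q^{ac}$ and fixes $t$, for every injective ring homomorphism $\mathbb{T}\to\mathbb{K}$ that commutes with $\tau$. -/

import Mathlib

open scoped NNReal Polynomial Topology

noncomputable section

namespace Carlitz

/-! ### The fields `K = F(θ)`, `K_∞` and `C_∞`, where `F` is the field with `q` elements -/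

section Fields

variable (F : Type*) [Field F]

open scoped Classical in
/-- `K_∞`, the completion of `K = F(θ)` at the infinity place. -/
abbrev KInf : Type _ := RatFunc.CompletionAtInfty F

open scoped Classical in
instance : CompleteSpace (KInf F) :=
  @UniformSpace.Completion.completeSpace (RatFunc F) (RatFunc.inftyValued F).toUniformSpace

open scoped Classical in
theorem valued_algebraMap (x : RatFunc F) :
    Valued.v (algebraMap (RatFunc F) (KInf F) x) = RatFunc.inftyValuation F x := by
  let := RatFunc.inftyValued F
  exact Valued.extensionValuation_apply_coe x

variable [Fintype F]

/-- The absolute value on `K_∞` is `q ^ (-v_∞)`, so that `|θ| = q`. -/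
instance : Valuation.RankOne (Valued.v (R := KInf F)) where
  hom' := (WithZeroMulInt.toNNReal (e := (Fintype.card F : ℝ≥0)) (by simp)).comp
    MonoidWithZeroHom.ValueGroup₀.embedding
  strictMono' := (WithZeroMulInt.toNNReal_strictMono
    (by exact_mod_cast Fintype.one_lt_card)).comp
      MonoidWithZeroHom.ValueGroup₀.embedding_strictMono
  exists_val_nontrivial := by
    refine ⟨algebraMap (RatFunc F) (KInf F) RatFunc.X, ?_⟩
    rw [valued_algebraMap, RatFunc.inftyValuation.X]
    simp

instance : NontriviallyNormedField (KInf F) := Valued.toNontriviallyNormedField (KInf F) _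

instance : IsUltrametricDist (KInf F) := inferInstance

/-- The unique extension of the absolute value to an algebraic closure of `K_∞`. -/
instance : NormedField (AlgebraicClosure (KInf F)) := spectralNorm.normedField (KInf F) _

instance : NormedAlgebra (KInf F) (AlgebraicClosure (KInf F)) := spectralNorm.normedAlgebra _ _

/-- `C_∞`, the completion of an algebraic closure of `K_∞`. -/
abbrev CInf : Type _ := UniformSpace.Completion (AlgebraicClosure (KInf F))

instance : IsUltrametricDist (CInf F) := IsUltrametricDist.of_normedAlgebra (KInf F)

instance : Algebra (RatFunc F) (CInf F) :=
  ((algebraMap (KInf F) (CInf F)).comp (algebraMap (RatFunc F) (KInf F))).toAlgebra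

instance : Algebra F (CInf F) :=
  ((algebraMap (RatFunc F) (CInf F)).comp (algebraMap F (RatFunc F))).toAlgebra

/-- The embedding of `A = F[θ]` in `C_∞`. -/
def ofA : F[X] →+* CInf F := (algebraMap (RatFunc F) (CInf F)).comp (algebraMap F[X] (RatFunc F))

/-- The element `θ` of `C_∞`. -/
def theta : CInf F := ofA F Polynomial.X

theorem one_lt_norm_theta : 1 < ‖theta F‖ := by
  have h : theta F =
      algebraMap (KInf F) (CInf F) (algebraMap (RatFunc F) (KInf F) RatFunc.X) :=
    congrArg (fun x ↦ algebraMap (KInf F) (CInf F) (algebraMap (RatFunc F) (KInf F) x))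
      RatFunc.algebraMap_X
  rw [h, norm_algebraMap', Valued.toNormedField.one_lt_norm_iff, valued_algebraMap,
    RatFunc.inftyValuation.X]
  exact WithZero.exp_lt_exp.2 one_pos

/-- `d_n`, the product of all monic polynomials of degree `n` in `A = F[θ]`
(there are finitely many of them). -/
def d (n : ℕ) : F[X] := ∏ᶠ a ∈ {a : F[X] | a.Monic ∧ a.natDegree = n}, a

/-- The Carlitz exponential on `C_∞`, `z ↦ ∑ d_n⁻¹ z ^ (q ^ n)`. -/
def expCInf (z : CInf F) : CInf F := ∑' n : ℕ, (ofA F (d F n))⁻¹ * z ^ Fintype.card F ^ n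

/-- `π` is a fundamental period `π̃` of the Carlitz exponential: `π ≠ 0` and the kernel `Λ` of
`exp_C : C_∞ → C_∞` is `π A`. Such an element is unique up to a factor in `Fˣ`. -/
def IsFundamentalPeriod (π : CInf F) : Prop :=
  π ≠ 0 ∧ {z : CInf F | expCInf F z = 0} = Set.range fun a : F[X] ↦ π * ofA F a

end Fields

/-! ### The Tate algebra `T` in one variable `t` over `C_∞` -/

section Tate

variable (F : Type*) [Field F] [Fintype F]

/-- The Tate algebra `T`: the formal series `∑ f_n t ^ n` over `C_∞` with `f_n → 0`. -/
abbrev Tate : Type _ := PowerSeries.IsRestricted.subring (R := CInf F) 1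

variable {F}

theorem mem_tate_iff {f : PowerSeries (CInf F)} :
    f ∈ PowerSeries.IsRestricted.subring (R := CInf F) 1 ↔
      Filter.Tendsto (fun n ↦ PowerSeries.coeff n f) Filter.atTop (𝓝 0) := by
  change PowerSeries.IsRestricted 1 f ↔ _
  simp only [PowerSeries.isRestricted_iff', one_pow, mul_one,
    tendsto_zero_iff_norm_tendsto_zero (f := fun n ↦ PowerSeries.coeff n f)]

theorem bddAbove_norm_coeff (f : Tate F) :
    BddAbove (Set.range fun n ↦ ‖PowerSeries.coeff n (f : PowerSeries (CInf F))‖) :=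
  (mem_tate_iff.1 f.2).norm.bddAbove_range

/-- The topology of `T` is given by the Gauss norm `‖f‖ = sup_n ‖f_n‖`. -/
instance : NormedAddCommGroup (Tate F) := AddGroupNorm.toNormedAddCommGroup
  { toFun := fun f ↦ ⨆ n, ‖PowerSeries.coeff n (f : PowerSeries (CInf F))‖
    map_zero' := by simp
    add_le' := fun f g ↦ ciSup_le fun n ↦ by
      rw [Subring.coe_add, map_add]
      exact (norm_add_le _ _).trans (add_le_add (le_ciSup (bddAbove_norm_coeff f) n)
        (le_ciSup (bddAbove_norm_coeff g) n))
    neg' := fun f ↦ by simp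
    eq_zero_of_map_eq_zero' := fun f hf ↦ by
      ext n
      have := le_ciSup (bddAbove_norm_coeff f) n
      rw [hf] at this
      simpa using this }

/-- The constants `C_∞ ⊆ T`. -/
def const : CInf F →+* Tate F where
  toFun c := ⟨PowerSeries.C c, PowerSeries.isRestricted_C 1 c⟩
  map_one' := by ext; simp
  map_mul' _ _ := by ext; simp
  map_zero' := by ext; simp
  map_add' _ _ := by ext; simp

variable (F) in
/-- The variable `t` of `T`. -/
def t : Tate F := ⟨PowerSeries.X, PowerSeries.isRestricted_monomial 1 1 1⟩

variable (F) in
/-- The endomorphism `τ` of `T`: `∑ f_n t ^ n ↦ ∑ f_n ^ q t ^ n`. -/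
def tau : Tate F →+* Tate F :=
  ((PowerSeries.map (FiniteField.frobeniusAlgHom F (CInf F) : CInf F →+* CInf F)).comp
    (Subring.subtype _)).codRestrict _ fun f ↦ by
      rw [mem_tate_iff]
      have h := (mem_tate_iff.1 f.2).pow (Fintype.card F)
      rw [zero_pow Fintype.card_ne_zero] at h
      simpa using h

/-- The `n`-th divided derivative `𝒟_n` on `T`, with `𝒟_n t ^ m = (m choose n) t ^ (m - n)`. -/
def dividedDeriv (n : ℕ) (f : Tate F) : Tate F :=
  ⟨PowerSeries.mk fun k ↦ ((k + n).choose n : CInf F) *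
      PowerSeries.coeff (k + n) (f : PowerSeries (CInf F)), by
    rw [mem_tate_iff]
    have h := (mem_tate_iff.1 f.2).comp (Filter.tendsto_add_atTop_nat n)
    refine squeeze_zero_norm (fun k ↦ ?_) (tendsto_zero_iff_norm_tendsto_zero.1 h)
    rw [PowerSeries.coeff_mk, norm_mul]
    exact mul_le_of_le_one_left (norm_nonneg _) (IsUltrametricDist.norm_natCast_le_one _ _)⟩

/-- The terms `d_k⁻¹ τ ^ k (f)` of the series `exp_C (f)`, for `f ∈ T`. -/
def expTerm (f : Tate F) (k : ℕ) : Tate F := const (ofA F (d F k))⁻¹ * (tau F)^[k] f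

/-- The Carlitz exponential on `T`. -/
def expTate (f : Tate F) : Tate F := ∑' k : ℕ, expTerm f k

variable (F) in
theorem thetaSubT_mul_inv : (PowerSeries.C (theta F) - PowerSeries.X) *
    PowerSeries.mk (fun n ↦ (theta F)⁻¹ ^ (n + 1)) = 1 := by
  have h0 : theta F ≠ 0 := norm_pos_iff.1 (one_pos.trans (one_lt_norm_theta F))
  ext n
  rw [sub_mul, map_sub, PowerSeries.coeff_C_mul, PowerSeries.coeff_mk, PowerSeries.coeff_one]
  cases n with
  | zero => simp [h0]
  | succ n =>
    rw [PowerSeries.coeff_succ_X_mul, PowerSeries.coeff_mk, pow_succ' _ (n + 1),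
      mul_inv_cancel_left₀ h0]
    simp

variable (F) in
/-- `θ - t` as a unit of `T`; its inverse is `∑ t ^ n / θ ^ (n + 1)`. -/
def thetaSubT : (Tate F)ˣ where
  val := const (theta F) - t F
  inv := ⟨PowerSeries.mk fun n ↦ (theta F)⁻¹ ^ (n + 1), by
    rw [mem_tate_iff]
    simp only [PowerSeries.coeff_mk]
    refine (tendsto_pow_atTop_nhds_zero_of_norm_lt_one ?_).comp (Filter.tendsto_add_atTop_nat 1)
    rw [norm_inv]
    exact inv_lt_one_of_one_lt₀ (one_lt_norm_theta F)⟩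
  val_inv := Subtype.ext (thetaSubT_mul_inv F)
  inv_val := Subtype.ext ((mul_comm _ _).trans (thetaSubT_mul_inv F))

/-- `f_i = π / (θ - t) ^ (i + 1)`. -/
def f (π : CInf F) (i : ℕ) : Tate F := const π * (↑(thetaSubT F)⁻¹ : Tate F) ^ (i + 1)

/-- The Anderson-Thakur function `ω = exp_C (π / (θ - t))`. -/
def omega (π : CInf F) : Tate F := expTate (const π * (↑(thetaSubT F)⁻¹ : Tate F))

variable (F) in
theorem tau_injective : Function.Injective (tau F) := by
  intro f g h
  ext n
  exact (FiniteField.frobeniusAlgHom F (CInf F) : CInf F →+* CInf F).injective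
    (by simpa [tau] using congrArg (fun x : Tate F ↦ PowerSeries.coeff n (x : PowerSeries (CInf F))) h)

variable (F) in
/-- The endomorphism `τ` of the fraction field of `T`. -/
def tauFrac : FractionRing (Tate F) →+* FractionRing (Tate F) :=
  IsFractionRing.map (tau_injective F)

end Tate

/-! ### The complete difference field `𝕂` of generalised series -/

section Hahn

variable (F : Type*) [Field F] [Fintype F]

/-- `𝕂`, the field of the generalised series `∑ c_i θ ^ (-i)` with coefficients `c_i` in
`F^ac(t)` and well-ordered support in `ℚ`; the coefficient of `θ ^ (-i)` has index `i`. -/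
abbrev HahnK : Type _ := HahnSeries ℚ (RatFunc (AlgebraicClosure F))

/-- The endomorphism `τ` of `F^ac(t)`: it is `c ↦ c ^ q` on `F^ac`, and it fixes `t`. -/
def tauCoeff : RatFunc (AlgebraicClosure F) →+* RatFunc (AlgebraicClosure F) :=
  RatFunc.mapRingHom (Polynomial.mapRingHom
    (FiniteField.frobeniusAlgHom F (AlgebraicClosure F) : AlgebraicClosure F →+* AlgebraicClosure F))
    (nonZeroDivisors_le_comap_nonZeroDivisors_of_injective _
      (Polynomial.map_injective _ (RingHom.injective _)))

/-- The endomorphism `∑ c_i θ ^ (-i) ↦ ∑ τ(c_i) θ ^ (-i)` of `𝕂`. -/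
def tauCoeffHahn : HahnK F →+* HahnK F where
  toFun x := x.map (tauCoeff F)
  map_one' := HahnSeries.map_one (tauCoeff F).toMonoidWithZeroHom
  map_mul' _ _ := HahnSeries.map_mul (tauCoeff F).toNonUnitalRingHom
  map_zero' := by ext; simp
  map_add' _ _ := HahnSeries.map_add (tauCoeff F).toAddMonoidHom

/-- The endomorphism `τ` of `𝕂`: `∑ c_i θ ^ (-i) ↦ ∑ τ(c_i) θ ^ (-q i)`. -/
def tauHahn : HahnK F →+* HahnK F :=
  (HahnSeries.embDomainRingHom (AddMonoidHom.mulLeft (Fintype.card F : ℚ))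
    (mul_right_injective₀ (by simp))
    (fun _ _ ↦ mul_le_mul_iff_right₀ (by exact_mod_cast Fintype.card_pos))).comp (tauCoeffHahn F)

end Hahn

/-! ### Difference fields `(E, σ)` -/

section Difference

variable {E : Type*} [Field E] (σ : E →+* E) (L : Subfield E)

/-- `L(S)_σ`: the smallest subfield of `E` that contains `L` and `S` and is stable under `σ`. -/
def diffAdjoin (S : Set E) : IntermediateField L E :=
  sInf {M : IntermediateField L E | S ⊆ M ∧ ∀ x ∈ M, σ x ∈ M}

/-- The elements of `S` are transformally independent over `L`: the `σ ^ k (x)`, for `x ∈ S` and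
`k ≥ 0`, are algebraically independent over `L`. -/
def TransfIndep (S : Set E) : Prop :=
  AlgebraicIndependent L fun p : S × ℕ ↦ σ^[p.2] (p.1 : E)

/-- The transformal degree of `M` over `L`: the supremum of the cardinalities of the subsets of `M`
that are transformally independent over `L`. -/
def transfDeg (M : IntermediateField L E) : Cardinal :=
  ⨆ S : {S : Set E // S ⊆ M ∧ TransfIndep σ L S}, Cardinal.mk S.1

end Difference

section Main

variable {F : Type*} [Field F] [Fintype F] {E : Type*} [Field E]

/-- The subfield `K(t)` of a field `E` in which `T` is embedded by `ι`. -/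
def Kt (ι : Tate F →+* E) : Subfield E :=
  Subfield.closure (insert (ι (t F))
    (Set.range fun x : RatFunc F ↦ ι (const (algebraMap (RatFunc F) (CInf F) x))))

/-- The claims on the functions `𝒟_i(ω)`, seen in a field `E` with an endomorphism `σ`, in which
`T` is embedded by `ι`: they are algebraically independent over `K(t)` and, for each `n`, the
difference field that the first `n + 1` of them generate over `K(t)` has transformal degree `0` and
transcendence degree `n + 1` over `K(t)`. -/
def IndependentIn (π : CInf F) (σ : E →+* E) (ι : Tate F →+* E) : Prop :=
  AlgebraicIndependent (Kt ι) (fun i : ℕ ↦ ι (dividedDeriv i (omega π))) ∧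
  ∀ n : ℕ,
    transfDeg σ (Kt ι)
      (diffAdjoin σ (Kt ι) {x | ∃ i ≤ n, x = ι (dividedDeriv i (omega π))}) = 0 ∧
    Algebra.trdeg (Kt ι)
      (diffAdjoin σ (Kt ι) {x | ∃ i ≤ n, x = ι (dividedDeriv i (omega π))}) = n + 1

end Main

end Carlitz

end

/-!
The coefficients `w_k = exp_C(π / θ ^ (k + 1))` of `ω` are torsion points of the Carlitz module
`φ_θ(x) = x ^ q + θ x`: the Carlitz exponential acts on the Tate algebra coefficientwise
(`coeff_expTate`), and the product formula `d_{n + 1} = (θ ^ (q ^ (n + 1)) - θ) d_n ^ q`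
(`ofA_d_succ`) gives `exp_C(θ z) = θ exp_C(z) + exp_C(z) ^ q` (`expCInf_theta_mul`). This is the
equation `τ(ω) = (t - θ) ω`; the equations for the `𝒟_i(ω)` follow, since `𝒟_i` commutes with `τ`.

The algebraic independence of the `𝒟_i(ω)` comes from Galois conjugation of torsion points over `K`.
The polynomial `φ_{θ ^ (k + 1)} / φ_{θ ^ k}` is Eisenstein at `θ`
(`irreducible_torsionPoly`), so all torsion points of exact order `θ ^ (k + 1)` are conjugate over
`K`. If `g` is a power series with coefficients in the prime field and `g(0) ≠ 0`, then the
coefficients of `g ω` form another compatible system of such points. A polynomial relation between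
the `𝒟_i(ω)` over `A[t]` is a family of relations over `A` between the `w_k`, one for each power
of `t`, and each `w_j` with `j ≤ k` is a polynomial in `w_k`. Hence the relation also holds for the
`𝒟_i(g ω)` (`IsTorsionSeries.eval₂_hasseDeriv_eq_zero`). The vectors of the `𝒟_i(g ω)`, for
`i ≤ N`, are Zariski dense (`eq_zero_of_forall_eval_hasseDeriv_mul`), so the relation is trivial.

In any field in which the Tate algebra embeds compatibly with `τ`, the difference field generated by
`𝒟_0(ω), …, 𝒟_n(ω)` over `K(t)` is the field generated by these elements, so it has transcendence
degree `n + 1`; a nonempty transformally independent set would make this degree infinite.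
-/

noncomputable section

namespace Carlitz

/-! ### The product of the monic polynomials of given degree -/

section CarlitzProduct

variable {F : Type*} [Field F] [Fintype F] {L : Type*} [Field L] [Algebra F L]

/-- The homogeneous form of `∏ (x - a) = x ^ q - x`. -/
theorem prod_sub_algebraMap_mul (y D : L) :
    ∏ a : F, (y - algebraMap F L a * D) =
      y ^ Fintype.card F - D ^ (Fintype.card F - 1) * y := by
  have hq : 1 < Fintype.card F := Fintype.one_lt_card
  obtain ⟨r, hr⟩ : ∃ r, Fintype.card F = r + 1 := ⟨Fintype.card F - 1, by omega⟩
  by_cases hD : D = 0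
  · have : r ≠ 0 := by omega
    simp [hD, hr, this]
  have h1 : (Polynomial.X ^ Fintype.card F - Polynomial.X : F[X]) =
      ∏ a : F, (Polynomial.X - Polynomial.C a) := by
    have hm : (Polynomial.X ^ Fintype.card F - Polynomial.X : F[X]).Monic :=
      Polynomial.monic_X_pow_sub (by rw [Polynomial.degree_X]; exact_mod_cast hq)
    have hr := FiniteField.roots_X_pow_card_sub_X F
    have := Polynomial.prod_multiset_X_sub_C_of_monic_of_roots_card_eq hm (by
      rw [hr, FiniteField.X_pow_card_sub_X_natDegree_eq F hq]; rfl)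
    rw [hr] at this
    exact this.symm
  have h2 := congrArg (Polynomial.aeval (y / D)) h1
  simp only [map_sub, map_pow, Polynomial.aeval_X, map_prod, Polynomial.aeval_C] at h2
  calc ∏ a : F, (y - algebraMap F L a * D)
      = ∏ a : F, (D * (y / D - algebraMap F L a)) := by
        refine Finset.prod_congr rfl fun a _ ↦ ?_
        field_simp
    _ = D ^ Fintype.card F * ((y / D) ^ Fintype.card F - y / D) := by
        rw [Finset.prod_mul_distrib, h2]; simp
    _ = _ := by
        rw [hr, Nat.add_sub_cancel, mul_sub, ← mul_pow, pow_succ D, mul_assoc,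
          mul_div_cancel₀ y hD]

/-- The product `∏ (x - a)` over the polynomials `a` in `θ` of degree less than `n`, with
coefficients in `F`. -/
def carlitzE (F : Type*) [Field F] [Fintype F] {L : Type*} [Field L] [Algebra F L]
    (θ : L) (n : ℕ) (x : L) : L :=
  ∏ c : Fin n → F, (x - ∑ i, algebraMap F L (c i) * θ ^ (i : ℕ))

variable (θ : L)

theorem carlitzE_zero (x : L) : carlitzE F θ 0 x = x := by simp [carlitzE]

theorem carlitzE_succ_eq_prod (n : ℕ) (x : L) :
    carlitzE F θ (n + 1) x = ∏ a : F, carlitzE F θ n (x - algebraMap F L a * θ ^ n) := by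
  unfold carlitzE
  rw [← (Fin.insertNthEquiv (fun _ ↦ F) (Fin.last n)).prod_comp, Fintype.prod_prod_type]
  refine Finset.prod_congr rfl fun a _ ↦ Finset.prod_congr rfl fun c _ ↦ ?_
  rw [Fin.sum_univ_castSucc]
  simp
  ring

/-- The recursion at `n` uses the `F`-linearity of `carlitzE F θ n` and implies that of
`carlitzE F θ (n + 1)`, so the three claims are proved together. -/
theorem carlitzE_sub_and_smul (n : ℕ) :
    (∀ x y : L, carlitzE F θ n (x - y) = carlitzE F θ n x - carlitzE F θ n y) ∧
    (∀ (a : F) (x : L), carlitzE F θ n (algebraMap F L a * x) =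
      algebraMap F L a * carlitzE F θ n x) ∧
    ∀ x : L, carlitzE F θ (n + 1) x = carlitzE F θ n x ^ Fintype.card F -
      carlitzE F θ n (θ ^ n) ^ (Fintype.card F - 1) * carlitzE F θ n x := by
  have step : ∀ n, (∀ x y : L, carlitzE F θ n (x - y) = carlitzE F θ n x - carlitzE F θ n y) →
      (∀ (a : F) (x : L), carlitzE F θ n (algebraMap F L a * x) =
        algebraMap F L a * carlitzE F θ n x) →
      ∀ x : L, carlitzE F θ (n + 1) x = carlitzE F θ n x ^ Fintype.card F -
        carlitzE F θ n (θ ^ n) ^ (Fintype.card F - 1) * carlitzE F θ n x := by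
    intro n h1 h2 x
    rw [carlitzE_succ_eq_prod, ← prod_sub_algebraMap_mul]
    simp only [h1, h2]
  have sub_pow (x y : L) : (x - y) ^ Fintype.card F = x ^ Fintype.card F - y ^ Fintype.card F :=
    map_sub (FiniteField.frobeniusAlgHom F L) x y
  induction n with
  | zero =>
    have h1 : ∀ x y : L, carlitzE F θ 0 (x - y) = carlitzE F θ 0 x - carlitzE F θ 0 y := by
      simp [carlitzE_zero]
    have h2 : ∀ (a : F) (x : L), carlitzE F θ 0 (algebraMap F L a * x) =
        algebraMap F L a * carlitzE F θ 0 x := by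
      simp [carlitzE_zero]
    exact ⟨h1, h2, step 0 h1 h2⟩
  | succ n ih =>
    obtain ⟨h1, h2, h3⟩ := ih
    have h1' : ∀ x y : L, carlitzE F θ (n + 1) (x - y) =
        carlitzE F θ (n + 1) x - carlitzE F θ (n + 1) y := by
      intro x y
      rw [h3, h3, h3, h1, sub_pow]
      ring
    have h2' : ∀ (a : F) (x : L), carlitzE F θ (n + 1) (algebraMap F L a * x) =
        algebraMap F L a * carlitzE F θ (n + 1) x := by
      intro a x
      rw [h3, h3, h2, mul_pow, ← map_pow, FiniteField.pow_card]
      ring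
    exact ⟨h1', h2', step _ h1' h2'⟩

theorem carlitzE_succ (n : ℕ) (x : L) :
    carlitzE F θ (n + 1) x = carlitzE F θ n x ^ Fintype.card F -
      carlitzE F θ n (θ ^ n) ^ (Fintype.card F - 1) * carlitzE F θ n x :=
  (carlitzE_sub_and_smul θ n).2.2 x

theorem carlitzE_succ_pow_self (n : ℕ) : carlitzE F θ (n + 1) (θ ^ n) = 0 := by
  rw [carlitzE_succ (F := F), pow_sub_one_mul Fintype.card_ne_zero, sub_self]

/-- The induction runs along the recursion `carlitzE_succ`, whose coefficient is computed by the
identity of the previous step at `x = θ ^ n`. -/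
theorem carlitzE_succ_mul (n : ℕ) : ∀ x : L, carlitzE F θ (n + 1) (θ * x) =
    θ * carlitzE F θ (n + 1) x +
      (θ ^ Fintype.card F ^ (n + 1) - θ) * carlitzE F θ n x ^ Fintype.card F := by
  have hq : Fintype.card F ≠ 0 := Fintype.card_ne_zero
  have add_pow (x y : L) : (x + y) ^ Fintype.card F = x ^ Fintype.card F + y ^ Fintype.card F :=
    map_add (FiniteField.frobeniusAlgHom F L) x y
  have sub_pow (x y : L) : (x - y) ^ Fintype.card F = x ^ Fintype.card F - y ^ Fintype.card F :=
    map_sub (FiniteField.frobeniusAlgHom F L) x y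
  induction n with
  | zero =>
    intro x
    simp only [carlitzE_succ, carlitzE_zero, pow_zero, one_pow, zero_add, pow_one]
    ring
  | succ n ih =>
    intro x
    have hD : carlitzE F θ (n + 1) (θ ^ (n + 1)) =
        (θ ^ Fintype.card F ^ (n + 1) - θ) * carlitzE F θ n (θ ^ n) ^ Fintype.card F := by
      rw [pow_succ', ih, carlitzE_succ_pow_self, mul_zero, zero_add]
    rw [carlitzE_succ θ (n + 1), carlitzE_succ θ (n + 1) x, ih x, hD, add_pow]
    set B := θ ^ Fintype.card F ^ (n + 1) - θ with hB
    have hBq : B ^ Fintype.card F = θ ^ Fintype.card F ^ (n + 1 + 1) - θ ^ Fintype.card F := by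
      rw [hB, sub_pow, ← pow_mul, ← pow_succ]
    have hE := carlitzE_succ (F := F) θ n x
    set y := carlitzE F θ n x
    set z := carlitzE F θ n (θ ^ n)
    have hEq : carlitzE F θ (n + 1) x ^ Fintype.card F = (y ^ Fintype.card F) ^ Fintype.card F -
        (z ^ (Fintype.card F - 1)) ^ Fintype.card F * y ^ Fintype.card F := by
      rw [hE, sub_pow, mul_pow]
    have hBz : (B * z ^ Fintype.card F) ^ (Fintype.card F - 1) * B =
        B ^ Fintype.card F * (z ^ (Fintype.card F - 1)) ^ Fintype.card F := by
      rw [mul_pow, ← pow_sub_one_mul hq B, ← pow_mul, ← pow_mul, mul_comm (Fintype.card F)]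
      ring
    have hpow : θ ^ Fintype.card F ^ (n + 1 + 1) = B ^ Fintype.card F + θ ^ Fintype.card F := by
      rw [hBq]; ring
    rw [mul_pow, mul_pow, hpow]
    generalize B ^ Fintype.card F = b at *
    generalize carlitzE F θ (n + 1) x ^ Fintype.card F = e at *
    generalize carlitzE F θ (n + 1) x = e' at *
    linear_combination (-b) * hEq - y ^ Fintype.card F * hBz

theorem carlitzE_succ_pow_succ (n : ℕ) : carlitzE F θ (n + 1) (θ ^ (n + 1)) =
    (θ ^ Fintype.card F ^ (n + 1) - θ) * carlitzE F θ n (θ ^ n) ^ Fintype.card F := by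
  rw [pow_succ', carlitzE_succ_mul, carlitzE_succ_pow_self, mul_zero, zero_add]

open Polynomial in
theorem d_eq_prod (n : ℕ) :
    d F n = ∏ c : Fin n → F, (X ^ n - ∑ i, C (c i) * X ^ (i : ℕ) : F[X]) := by
  have hcoeff (c : Fin n → F) (i : Fin n) :
      (X ^ n - ∑ i, C (c i) * X ^ (i : ℕ) : F[X]).coeff i = -c i := by
    simp [coeff_X_pow, i.2.ne, Fin.val_inj]
  have hdeg (c : Fin n → F) : (∑ i, C (c i) * X ^ (i : ℕ) : F[X]).degree < n :=
    mem_degreeLT.1 (Submodule.sum_mem _ fun i _ ↦ mem_degreeLT.2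
      ((degree_C_mul_X_pow_le _ _).trans_lt (by exact_mod_cast i.2)))
  have hset : {a : F[X] | a.Monic ∧ a.natDegree = n} =
      Set.range fun c : Fin n → F ↦ (X ^ n - ∑ i, C (c i) * X ^ (i : ℕ) : F[X]) := by
    ext a
    constructor
    · rintro ⟨hm, hn⟩
      refine ⟨fun i ↦ -a.coeff i, ?_⟩
      conv_rhs => rw [hm.as_sum, hn, Finset.sum_range]
      simp
    · rintro ⟨c, rfl⟩
      have h := hdeg c
      refine ⟨monic_X_pow_sub h, ?_⟩
      rw [natDegree_eq_of_degree_eq_some]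
      rw [degree_sub_eq_left_of_degree_lt (by rwa [degree_X_pow]), degree_X_pow]
  rw [d, hset, finprod_mem_range, finprod_eq_prod_of_fintype]
  intro c c' h
  ext i
  simpa [hcoeff] using congrArg (fun p : F[X] ↦ p.coeff i) h

end CarlitzProduct

/-! ### The Carlitz exponential on `C_∞` -/

section ExpCInf

variable (F : Type*) [Field F] [Fintype F]

theorem ofA_C (c : F) : ofA F (Polynomial.C c) = algebraMap F (CInf F) c := by
  change algebraMap (RatFunc F) (CInf F) _ = algebraMap (RatFunc F) (CInf F) _
  rw [IsScalarTower.algebraMap_apply F F[X] (RatFunc F) c]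
  rfl

theorem ofA_d (n : ℕ) : ofA F (d F n) = carlitzE F (theta F) n (theta F ^ n) := by
  rw [d_eq_prod, map_prod, carlitzE]
  simp only [map_sub, map_pow, map_sum, map_mul, ofA_C]
  rfl

theorem ofA_d_zero : ofA F (d F 0) = 1 := by rw [ofA_d, carlitzE_zero, pow_zero]

theorem ofA_d_succ (n : ℕ) : ofA F (d F (n + 1)) =
    (theta F ^ Fintype.card F ^ (n + 1) - theta F) * ofA F (d F n) ^ Fintype.card F := by
  rw [ofA_d, ofA_d, carlitzE_succ_pow_succ]

theorem norm_theta_pow_sub (n : ℕ) :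
    ‖theta F ^ Fintype.card F ^ (n + 1) - theta F‖ = ‖theta F‖ ^ Fintype.card F ^ (n + 1) := by
  have h : ‖theta F‖ < ‖theta F ^ Fintype.card F ^ (n + 1)‖ := by
    rw [norm_pow]
    exact lt_self_pow₀ (one_lt_norm_theta F) (Nat.one_lt_pow n.succ_ne_zero Fintype.one_lt_card)
  rw [← norm_pow, sub_eq_add_neg, IsUltrametricDist.norm_add_eq_max_of_norm_ne_norm
    (by rw [norm_neg]; exact h.ne'), norm_neg, max_eq_left h.le]

theorem norm_ofA_d (n : ℕ) : ‖ofA F (d F n)‖ = (‖theta F‖ ^ n) ^ Fintype.card F ^ n := by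
  induction n with
  | zero => simp [ofA_d_zero]
  | succ n ih =>
    rw [ofA_d_succ, norm_mul, norm_theta_pow_sub, norm_pow, ih]
    ring

theorem ofA_d_ne_zero (n : ℕ) : ofA F (d F n) ≠ 0 := by
  rw [← norm_pos_iff, norm_ofA_d]
  have := one_pos.trans (one_lt_norm_theta F)
  positivity

/-- The general term of the exponential series is eventually dominated by a geometric progression. -/
theorem summable_norm_ofA_d_inv_mul_pow (r : ℝ) (hr : 0 ≤ r) :
    Summable fun k : ℕ ↦ ‖(ofA F (d F k))⁻¹‖ * r ^ Fintype.card F ^ k := by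
  have hθ := one_lt_norm_theta F
  have hθ0 := one_pos.trans hθ
  have hterm (k : ℕ) : ‖(ofA F (d F k))⁻¹‖ * r ^ Fintype.card F ^ k =
      (r * ‖theta F‖⁻¹ ^ k) ^ Fintype.card F ^ k := by
    rw [norm_inv, norm_ofA_d, mul_pow, inv_pow, inv_pow, mul_comm]
  have hgeom : Summable fun k : ℕ ↦ r * ‖theta F‖⁻¹ ^ k :=
    (summable_geometric_of_lt_one (by positivity) (inv_lt_one_of_one_lt₀ hθ)).mul_left r
  simp only [hterm]
  refine Summable.of_norm_bounded_eventually_nat hgeom ?_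
  filter_upwards [hgeom.tendsto_atTop_zero.eventually_le_const one_pos] with k hk
  have h0 : 0 ≤ r * ‖theta F‖⁻¹ ^ k := by positivity
  rw [norm_pow, Real.norm_of_nonneg h0]
  exact pow_le_of_le_one h0 hk (pow_ne_zero _ Fintype.card_ne_zero)

theorem summable_expCInf (z : CInf F) :
    Summable fun k : ℕ ↦ (ofA F (d F k))⁻¹ * z ^ Fintype.card F ^ k :=
  Summable.of_norm (by
    simpa only [norm_mul, norm_pow] using summable_norm_ofA_d_inv_mul_pow F ‖z‖ (norm_nonneg z))

theorem expCInf_natCast_mul (m : ℕ) (z : CInf F) : expCInf F (m * z) = m * expCInf F z := by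
  rw [expCInf, expCInf, ← tsum_mul_left]
  have h (k : ℕ) : (m : CInf F) ^ Fintype.card F ^ k = m := by
    induction k with
    | zero => simp
    | succ k ih =>
      rw [pow_succ, pow_mul, ih]
      exact map_natCast (FiniteField.frobeniusAlgHom F (CInf F)) m
  refine tsum_congr fun k ↦ ?_
  rw [mul_pow, h]
  ring

/-- The functional equation of the Carlitz exponential. -/
theorem expCInf_theta_mul (z : CInf F) :
    expCInf F (theta F * z) = theta F * expCInf F z + expCInf F z ^ Fintype.card F := by
  have hs := summable_expCInf F z
  have hfrob : expCInf F z ^ Fintype.card F =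
      ∑' k : ℕ, ((ofA F (d F k))⁻¹ * z ^ Fintype.card F ^ k) ^ Fintype.card F :=
    hs.map_tsum (FiniteField.frobeniusAlgHom F (CInf F))
      (continuous_pow (M := CInf F) (Fintype.card F))
  have hsfrob : Summable fun k : ℕ ↦
      ((ofA F (d F k))⁻¹ * z ^ Fintype.card F ^ k) ^ Fintype.card F :=
    hs.map (FiniteField.frobeniusAlgHom F (CInf F)) (continuous_pow (M := CInf F) (Fintype.card F))
  have hterm (k : ℕ) : (ofA F (d F (k + 1)))⁻¹ * (theta F * z) ^ Fintype.card F ^ (k + 1) =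
      theta F * ((ofA F (d F (k + 1)))⁻¹ * z ^ Fintype.card F ^ (k + 1)) +
        ((ofA F (d F k))⁻¹ * z ^ Fintype.card F ^ k) ^ Fintype.card F := by
    have hd := ofA_d_ne_zero F (k + 1)
    have hk := ofA_d_ne_zero F k
    have hrec := ofA_d_succ F k
    have hpow : (z ^ Fintype.card F ^ k) ^ Fintype.card F = z ^ Fintype.card F ^ (k + 1) := by
      rw [← pow_mul, ← pow_succ]
    have hq : ofA F (d F k) ^ Fintype.card F ≠ 0 := pow_ne_zero _ hk
    rw [mul_pow, mul_pow, hpow, inv_pow]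
    have hinv : (ofA F (d F k) ^ Fintype.card F)⁻¹ = (ofA F (d F (k + 1)))⁻¹ *
        (theta F ^ Fintype.card F ^ (k + 1) - theta F) := by
      rw [inv_eq_iff_eq_inv, mul_inv, inv_inv, eq_mul_inv_iff_mul_eq₀, hrec, mul_comm]
      rintro h
      rw [hrec, h, zero_mul] at hd
      exact hd rfl
    rw [hinv]
    ring
  have hs' := (summable_nat_add_iff 1).2 hs
  rw [hfrob]
  unfold expCInf
  rw [(summable_expCInf F (theta F * z)).tsum_eq_zero_add, hs.tsum_eq_zero_add]
  simp only [hterm]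
  rw [(hs'.mul_left (theta F)).tsum_add hsfrob, tsum_mul_left]
  simp only [ofA_d_zero, pow_zero, pow_one]
  ring

variable {F}

theorem IsFundamentalPeriod.expCInf_eq_zero {π : CInf F} (hπ : IsFundamentalPeriod F π) :
    expCInf F π = 0 := by
  have : π ∈ {z : CInf F | expCInf F z = 0} := by
    rw [hπ.2]
    exact ⟨1, by simp⟩
  exact this

/-- `π / θ` is not a period, since `θ` is not a unit of `A`. -/
theorem IsFundamentalPeriod.expCInf_mul_theta_inv_ne_zero {π : CInf F}
    (hπ : IsFundamentalPeriod F π) : expCInf F (π * (theta F)⁻¹) ≠ 0 := by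
  intro h
  have hmem : π * (theta F)⁻¹ ∈ {z : CInf F | expCInf F z = 0} := h
  rw [hπ.2] at hmem
  obtain ⟨a, ha⟩ := hmem
  have hθ : theta F ≠ 0 := norm_pos_iff.1 (one_pos.trans (one_lt_norm_theta F))
  have h1 : ofA F (a * Polynomial.X) = ofA F 1 := by
    rw [map_mul, map_one, mul_left_cancel₀ hπ.1 ha]
    exact inv_mul_cancel₀ hθ
  have hinj : Function.Injective (ofA F) := by
    rw [ofA, RingHom.coe_comp]
    exact (algebraMap (RatFunc F) (CInf F)).injective.comp (RatFunc.algebraMap_injective F)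
  exact Polynomial.not_isUnit_X (IsUnit.of_mul_eq_one_right a (hinj h1))

end ExpCInf

/-! ### The Carlitz exponential on the Tate algebra -/

section ExpTate

variable {F : Type*} [Field F] [Fintype F]

theorem Tate.norm_eq_iSup (f : Tate F) :
    ‖f‖ = ⨆ n, ‖PowerSeries.coeff n (f : PowerSeries (CInf F))‖ := rfl

theorem Tate.norm_coeff_le (f : Tate F) (n : ℕ) :
    ‖PowerSeries.coeff n (f : PowerSeries (CInf F))‖ ≤ ‖f‖ :=
  le_ciSup (bddAbove_norm_coeff f) n

/-- The elements of the Tate algebra are the sequences in `C_∞` that tend to zero, with the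
supremum norm. -/
def Tate.toZeroAtInfty (f : Tate F) : ZeroAtInftyContinuousMap ℕ (CInf F) where
  toFun n := PowerSeries.coeff n (f : PowerSeries (CInf F))
  continuous_toFun := continuous_of_discreteTopology
  zero_at_infty' := by
    rw [Filter.cocompact_eq_cofinite, Nat.cofinite_eq_atTop]
    exact mem_tate_iff.1 f.2

theorem Tate.isometry_toZeroAtInfty : Isometry (Tate.toZeroAtInfty (F := F)) := by
  refine Isometry.of_dist_eq fun f g ↦ ?_
  rw [dist_eq_norm, dist_eq_norm, ← ZeroAtInftyContinuousMap.norm_toBCF_eq_norm,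
    BoundedContinuousFunction.norm_eq_iSup_norm, Tate.norm_eq_iSup]
  rfl

theorem Tate.surjective_toZeroAtInfty : Function.Surjective (Tate.toZeroAtInfty (F := F)) := by
  intro u
  refine ⟨⟨PowerSeries.mk u, mem_tate_iff.2 ?_⟩, ?_⟩
  · have := u.zero_at_infty'
    rw [Filter.cocompact_eq_cofinite, Nat.cofinite_eq_atTop] at this
    simp only [PowerSeries.coeff_mk]
    exact this
  · ext n
    simp [Tate.toZeroAtInfty]

instance : CompleteSpace (Tate F) :=
  (Tate.isometry_toZeroAtInfty.isUniformInducing.completeSpace_congr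
    Tate.surjective_toZeroAtInfty).2 inferInstance

/-- The `n`-th coefficient, as an additive map on the Tate algebra. -/
def Tate.coeffHom (F : Type*) [Field F] [Fintype F] (n : ℕ) : Tate F →+ CInf F where
  toFun f := PowerSeries.coeff n (f : PowerSeries (CInf F))
  map_zero' := by simp
  map_add' f g := by simp

theorem Tate.continuous_coeffHom (n : ℕ) : Continuous (Tate.coeffHom F n) :=
  AddMonoidHomClass.continuous_of_bound (Tate.coeffHom F n) 1 fun f ↦ by
    rw [one_mul]
    exact Tate.norm_coeff_le f n

theorem coeff_tau (f : Tate F) (n : ℕ) :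
    PowerSeries.coeff n (tau F f : PowerSeries (CInf F)) =
      PowerSeries.coeff n (f : PowerSeries (CInf F)) ^ Fintype.card F := by
  simp [tau]

theorem coeff_expTerm (f : Tate F) (k n : ℕ) :
    PowerSeries.coeff n (expTerm f k : PowerSeries (CInf F)) =
      (ofA F (d F k))⁻¹ * PowerSeries.coeff n (f : PowerSeries (CInf F)) ^ Fintype.card F ^ k := by
  have h : PowerSeries.coeff n ((tau F)^[k] f : PowerSeries (CInf F)) =
      PowerSeries.coeff n (f : PowerSeries (CInf F)) ^ Fintype.card F ^ k := by
    induction k with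
    | zero => simp
    | succ k ih => rw [Function.iterate_succ_apply', coeff_tau, ih, ← pow_mul, ← pow_succ]
  rw [← h]
  exact PowerSeries.coeff_C_mul _ _ _

theorem summable_expTerm (f : Tate F) : Summable (expTerm f) := by
  refine Summable.of_norm_bounded (summable_norm_ofA_d_inv_mul_pow F ‖f‖ (norm_nonneg f))
    fun k ↦ ciSup_le fun n ↦ ?_
  rw [coeff_expTerm, norm_mul, norm_pow]
  gcongr
  exact Tate.norm_coeff_le f n

/-- The Carlitz exponential acts on the Tate algebra coefficientwise. -/
theorem coeff_expTate (f : Tate F) (n : ℕ) :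
    PowerSeries.coeff n (expTate f : PowerSeries (CInf F)) =
      expCInf F (PowerSeries.coeff n (f : PowerSeries (CInf F))) := by
  have h := (summable_expTerm f).map_tsum (Tate.coeffHom F n) (Tate.continuous_coeffHom n)
  simp only [expCInf, ← coeff_expTerm]
  exact h

theorem coeff_dividedDeriv (i : ℕ) (f : Tate F) (n : ℕ) :
    PowerSeries.coeff n (dividedDeriv i f : PowerSeries (CInf F)) =
      ((n + i).choose i : CInf F) * PowerSeries.coeff (n + i) (f : PowerSeries (CInf F)) := by
  simp [dividedDeriv]

theorem expTate_dividedDeriv (i : ℕ) (f : Tate F) :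
    expTate (dividedDeriv i f) = dividedDeriv i (expTate f) := by
  ext n
  simp only [coeff_expTate, coeff_dividedDeriv, expCInf_natCast_mul]

theorem coeff_f (π : CInf F) (i n : ℕ) :
    PowerSeries.coeff n (f π i : PowerSeries (CInf F)) =
      ((n + i).choose i : CInf F) * (π * (theta F)⁻¹ ^ (n + i + 1)) := by
  have h : PowerSeries.mk (fun n ↦ (theta F)⁻¹ ^ (n + 1)) =
      PowerSeries.C (theta F)⁻¹ * PowerSeries.rescale (theta F)⁻¹ (PowerSeries.mk 1) := by
    ext n
    simp [pow_succ']
  have hcoe : (f π i : PowerSeries (CInf F)) =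
      PowerSeries.C π * PowerSeries.mk (fun n ↦ (theta F)⁻¹ ^ (n + 1)) ^ (i + 1) := rfl
  rw [hcoe, h, mul_pow, ← map_pow, ← map_pow, PowerSeries.mk_one_pow_eq_mk_choose_add,
    PowerSeries.coeff_C_mul, PowerSeries.coeff_C_mul, PowerSeries.coeff_rescale,
    PowerSeries.coeff_mk, add_comm i n]
  ring

theorem f_eq_dividedDeriv (π : CInf F) (i : ℕ) : f π i = dividedDeriv i (f π 0) := by
  ext n
  rw [coeff_dividedDeriv, coeff_f, coeff_f]
  simp

theorem omega_eq (π : CInf F) : omega π = expTate (f π 0) := by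
  rw [omega, f, zero_add, pow_one]

theorem expTate_f (π : CInf F) (i : ℕ) : expTate (f π i) = dividedDeriv i (omega π) := by
  rw [f_eq_dividedDeriv, expTate_dividedDeriv, omega_eq]

theorem coeff_omega (π : CInf F) (n : ℕ) :
    PowerSeries.coeff n (omega π : PowerSeries (CInf F)) =
      expCInf F (π * (theta F)⁻¹ ^ (n + 1)) := by
  rw [omega_eq, coeff_expTate, coeff_f]
  simp

theorem tau_omega {π : CInf F} (hπ : IsFundamentalPeriod F π) :
    tau F (omega π) = (t F - const (theta F)) * omega π := by
  have hθ : theta F ≠ 0 := norm_pos_iff.1 (one_pos.trans (one_lt_norm_theta F))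
  have hmul (n : ℕ) : theta F * (π * (theta F)⁻¹ ^ (n + 1)) = π * (theta F)⁻¹ ^ n := by
    rw [pow_succ]
    field_simp
  have hcoe : ((t F - const (theta F)) * omega π : PowerSeries (CInf F)) =
      PowerSeries.X * (omega π : PowerSeries (CInf F)) -
        PowerSeries.C (theta F) * (omega π : PowerSeries (CInf F)) := sub_mul _ _ _
  ext n
  change _ = PowerSeries.coeff n ((t F - const (theta F)) * omega π : PowerSeries (CInf F))
  have hfe := expCInf_theta_mul F (π * (theta F)⁻¹ ^ (n + 1))
  rw [hmul] at hfe
  rw [hcoe, map_sub, PowerSeries.coeff_C_mul, coeff_tau, coeff_omega]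
  cases n with
  | zero =>
    rw [pow_zero, mul_one, hπ.expCInf_eq_zero] at hfe
    rw [PowerSeries.coeff_zero_X_mul]
    linear_combination -hfe
  | succ n =>
    rw [PowerSeries.coeff_succ_X_mul, coeff_omega]
    linear_combination -hfe

theorem tau_dividedDeriv (i : ℕ) (f : Tate F) :
    tau F (dividedDeriv i f) = dividedDeriv i (tau F f) := by
  ext n
  simp only [coeff_tau, coeff_dividedDeriv, mul_pow]
  congr 1
  exact map_natCast (FiniteField.frobeniusAlgHom F (CInf F)) _

theorem dividedDeriv_zero (f : Tate F) : dividedDeriv 0 f = f := by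
  ext n
  simp [coeff_dividedDeriv]

theorem dividedDeriv_succ_t_sub_const_mul (i : ℕ) (c : CInf F) (f : Tate F) :
    dividedDeriv (i + 1) ((t F - const c) * f) =
      (t F - const c) * dividedDeriv (i + 1) f + dividedDeriv i f := by
  have hcoe (g : Tate F) : (((t F - const c) * g : Tate F) : PowerSeries (CInf F)) =
      PowerSeries.X * (g : PowerSeries (CInf F)) -
        PowerSeries.C c * (g : PowerSeries (CInf F)) := sub_mul _ _ _
  ext n
  rw [Subring.coe_add, map_add, hcoe, map_sub, PowerSeries.coeff_C_mul, coeff_dividedDeriv, hcoe,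
    map_sub, PowerSeries.coeff_C_mul, coeff_dividedDeriv, coeff_dividedDeriv, ← add_assoc,
    PowerSeries.coeff_succ_X_mul]
  cases n with
  | zero =>
    rw [PowerSeries.coeff_zero_X_mul]
    simp
    ring
  | succ n =>
    rw [PowerSeries.coeff_succ_X_mul, coeff_dividedDeriv, show n + 1 + i = n + (i + 1) by ring,
      Nat.choose_succ_succ]
    push_cast
    ring

theorem tau_dividedDeriv_zero_omega {π : CInf F} (hπ : IsFundamentalPeriod F π) :
    tau F (dividedDeriv 0 (omega π)) =
      (t F - const (theta F)) * dividedDeriv 0 (omega π) := by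
  rw [dividedDeriv_zero, tau_omega hπ]

theorem tau_dividedDeriv_succ_omega {π : CInf F} (hπ : IsFundamentalPeriod F π) (i : ℕ) :
    tau F (dividedDeriv (i + 1) (omega π)) =
      (t F - const (theta F)) * dividedDeriv (i + 1) (omega π) + dividedDeriv i (omega π) := by
  rw [tau_dividedDeriv, tau_omega hπ, dividedDeriv_succ_t_sub_const_mul]

end ExpTate

/-! ### Torsion polynomials of the Carlitz module -/

section Torsion

open Polynomial in
/-- The polynomial `x ↦ φ_{θ ^ k}(x)` over `A = F[θ]`, where `φ` is the Carlitz module, with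
`φ_θ(x) = x ^ q + θ x`. -/
def carlitzIter (F : Type*) [Field F] [Fintype F] : ℕ → F[X][X]
  | 0 => X
  | k + 1 => carlitzIter F k ^ Fintype.card F + C X * carlitzIter F k

open Polynomial in
/-- The polynomial `φ_{θ ^ (k + 1)}(x) / φ_{θ ^ k}(x)`, whose roots are the torsion points of exact
order `θ ^ (k + 1)`. -/
def torsionPoly (F : Type*) [Field F] [Fintype F] (k : ℕ) : F[X][X] :=
  carlitzIter F k ^ (Fintype.card F - 1) + C X

variable (F : Type*) [Field F] [Fintype F]

open Polynomial in
theorem carlitzIter_monic_natDegree (k : ℕ) :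
    (carlitzIter F k).Monic ∧ (carlitzIter F k).natDegree = Fintype.card F ^ k := by
  induction k with
  | zero => exact ⟨monic_X, by simp [carlitzIter]⟩
  | succ k ih =>
    obtain ⟨hm, hd⟩ := ih
    have hlt : (C X * carlitzIter F k).degree < (carlitzIter F k ^ Fintype.card F).degree := by
      rw [degree_C_mul X_ne_zero, degree_eq_natDegree hm.ne_zero,
        degree_eq_natDegree (hm.pow _).ne_zero, hm.natDegree_pow, hd]
      exact_mod_cast lt_mul_of_one_lt_left (pow_pos Fintype.card_pos k) Fintype.one_lt_card
    refine ⟨(hm.pow _).add_of_left hlt, ?_⟩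
    rw [carlitzIter, natDegree_add_eq_left_of_degree_lt hlt, hm.natDegree_pow, hd, pow_succ']

open Polynomial in
theorem torsionPoly_monic_natDegree (k : ℕ) : (torsionPoly F k).Monic ∧
    (torsionPoly F k).natDegree = (Fintype.card F - 1) * Fintype.card F ^ k := by
  obtain ⟨hm, hd⟩ := carlitzIter_monic_natDegree F k
  have hlt : (C (X : F[X])).degree < (carlitzIter F k ^ (Fintype.card F - 1)).degree := by
    refine degree_C_le.trans_lt ?_
    rw [degree_eq_natDegree (hm.pow _).ne_zero, hm.natDegree_pow, hd]
    exact_mod_cast mul_pos (Nat.sub_pos_of_lt Fintype.one_lt_card) (pow_pos Fintype.card_pos k)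
  refine ⟨(hm.pow _).add_of_left hlt, ?_⟩
  rw [torsionPoly, natDegree_add_eq_left_of_degree_lt hlt, hm.natDegree_pow, hd]

open Polynomial in
theorem map_constantCoeff_torsionPoly (k : ℕ) : (torsionPoly F k).map constantCoeff =
    X ^ ((Fintype.card F - 1) * Fintype.card F ^ k) := by
  have h : (carlitzIter F k).map constantCoeff = X ^ Fintype.card F ^ k := by
    induction k with
    | zero => simp [carlitzIter]
    | succ k ih =>
      simp only [carlitzIter, Polynomial.map_add, Polynomial.map_mul, Polynomial.map_pow, ih]
      rw [← pow_mul, ← pow_succ]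
      simp
  simp only [torsionPoly, Polynomial.map_add, Polynomial.map_pow, h]
  rw [← pow_mul, mul_comm]
  simp

open Polynomial in
theorem coeff_zero_torsionPoly (k : ℕ) : (torsionPoly F k).coeff 0 = X := by
  have h : (carlitzIter F k).eval 0 = 0 := by
    induction k with
    | zero => simp [carlitzIter]
    | succ k ih => simp [carlitzIter, ih]
  have hq : Fintype.card F - 1 ≠ 0 := (Nat.sub_pos_of_lt Fintype.one_lt_card).ne'
  rw [coeff_zero_eq_eval_zero]
  simp [torsionPoly, h, hq]

open Polynomial in
/-- The polynomial is Eisenstein at `θ`. -/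
theorem irreducible_torsionPoly (k : ℕ) : Irreducible (torsionPoly F k) := by
  obtain ⟨hm, hd⟩ := torsionPoly_monic_natDegree F k
  have hpos : 0 < (torsionPoly F k).natDegree := by
    rw [hd]
    exact mul_pos (Nat.sub_pos_of_lt Fintype.one_lt_card) (pow_pos Fintype.card_pos k)
  have hprime : (Ideal.span {(X : F[X])}).IsPrime :=
    (Ideal.span_singleton_prime X_ne_zero).2 prime_X
  refine IsEisensteinAt.irreducible (𝓟 := Ideal.span {X}) ⟨?_, ?_, ?_⟩ hprime hm.isPrimitive hpos
  · rw [hm.leadingCoeff]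
    exact fun h ↦ hprime.ne_top ((Ideal.eq_top_iff_one _).2 h)
  · intro n hn
    have := congrArg (fun p ↦ p.coeff n) (map_constantCoeff_torsionPoly F k)
    rw [hd] at hn
    simp only [coeff_map, coeff_X_pow, hn.ne, if_false, constantCoeff_apply] at this
    rwa [Ideal.mem_span_singleton, X_dvd_iff]
  · rw [coeff_zero_torsionPoly, Ideal.span_singleton_pow, Ideal.mem_span_singleton]
    intro h
    have := natDegree_le_of_dvd h X_ne_zero
    simp at this

end Torsion

/-! ### Generating series of torsion points -/

section TorsionSeries

open PowerSeries

variable (F : Type*) [Field F] [Fintype F] {C : Type*} [Field C] [Algebra F C] [Algebra F[X] C]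

/-- The generating series of a compatible system of torsion points `w_k` of exact order
`θ ^ (k + 1)` for the Carlitz module. The equation is `φ_θ(w_{k + 1}) = w_k`, `φ_θ(w_0) = 0`, read
coefficientwise, with `θ` the image of the variable of `F[X]`. -/
def IsTorsionSeries (w : C⟦X⟧) : Prop :=
  constantCoeff w ≠ 0 ∧
    PowerSeries.map (FiniteField.frobeniusAlgHom F C : C →+* C) w =
      (X - PowerSeries.C (algebraMap F[X] C Polynomial.X)) * w

variable {F}

theorem IsTorsionSeries.mul {w : C⟦X⟧} (hw : IsTorsionSeries F w) {g : C⟦X⟧}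
    (hg0 : constantCoeff g ≠ 0)
    (hg : PowerSeries.map (FiniteField.frobeniusAlgHom F C : C →+* C) g = g) :
    IsTorsionSeries F (g * w) := by
  refine ⟨by rw [map_mul]; exact mul_ne_zero hg0 hw.1, ?_⟩
  rw [map_mul, hg, hw.2]
  ring

theorem IsTorsionSeries.coeff_succ {w : C⟦X⟧} (hw : IsTorsionSeries F w) (k : ℕ) :
    coeff (k + 1) w ^ Fintype.card F + algebraMap F[X] C Polynomial.X * coeff (k + 1) w =
      coeff k w := by
  have := congrArg (coeff (k + 1)) hw.2
  rw [sub_mul, map_sub, PowerSeries.coeff_C_mul, coeff_succ_X_mul, coeff_map] at this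
  change coeff (k + 1) w ^ Fintype.card F = _ at this
  rw [this, sub_add_cancel]

theorem IsTorsionSeries.coeff_zero {w : C⟦X⟧} (hw : IsTorsionSeries F w) :
    coeff 0 w ^ (Fintype.card F - 1) + algebraMap F[X] C Polynomial.X = 0 := by
  have := congrArg (coeff 0) hw.2
  rw [sub_mul, map_sub, PowerSeries.coeff_C_mul, coeff_zero_X_mul, coeff_map] at this
  change coeff 0 w ^ Fintype.card F = _ at this
  have h0 : coeff 0 w ≠ 0 := by simpa using hw.1
  rw [← pow_sub_one_mul Fintype.card_ne_zero] at this
  refine (mul_eq_zero.1 ?_).resolve_right h0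
  rw [add_mul, this]
  ring

theorem IsTorsionSeries.aeval_carlitzIter {w : C⟦X⟧} (hw : IsTorsionSeries F w) (j : ℕ) :
    ∀ k, Polynomial.aeval (coeff (k + j) w) (carlitzIter F j) = coeff k w := by
  induction j with
  | zero => simp [carlitzIter]
  | succ j ih =>
    intro k
    rw [carlitzIter, map_add, map_pow, map_mul, Polynomial.aeval_C, show k + (j + 1) = k + 1 + j by
      ring, ih, hw.coeff_succ]

theorem IsTorsionSeries.aeval_torsionPoly {w : C⟦X⟧} (hw : IsTorsionSeries F w) (k : ℕ) :
    Polynomial.aeval (coeff k w) (torsionPoly F k) = 0 := by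
  have h := hw.aeval_carlitzIter k 0
  rw [zero_add] at h
  rw [torsionPoly, map_add, map_pow, h, Polynomial.aeval_C, hw.coeff_zero]

/-- The torsion points of exact order `θ ^ (k + 1)` are conjugate over `F(θ)`. -/
theorem IsTorsionSeries.aeval_eq_zero [FaithfulSMul F[X] C] {w w' : C⟦X⟧}
    (hw : IsTorsionSeries F w) (hw' : IsTorsionSeries F w') {k : ℕ} {R : F[X][X]}
    (hR : Polynomial.aeval (coeff k w) R = 0) : Polynomial.aeval (coeff k w') R = 0 := by
  have hm := (torsionPoly_monic_natDegree F k).1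
  have hint : IsIntegral F[X] (coeff k w) := ⟨_, hm, hw.aeval_torsionPoly k⟩
  obtain ⟨u, hu⟩ := minpoly.isIntegrallyClosed_dvd hint (hw.aeval_torsionPoly k)
  -- `torsionPoly F k` is the minimal polynomial up to a unit, and it also vanishes at `coeff k w'`.
  have hunit : IsUnit u := ((irreducible_torsionPoly F k).isUnit_or_isUnit hu).resolve_left
    (minpoly.not_isUnit _ _)
  obtain ⟨v, hv⟩ := minpoly.isIntegrallyClosed_dvd hint hR
  obtain ⟨u', hu'⟩ := hunit.exists_right_inv
  have h : R = torsionPoly F k * (u' * v) := by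
    rw [hv, hu]
    linear_combination (-minpoly F[X] (coeff k w) * v) * hu'
  rw [h, map_mul, hw'.aeval_torsionPoly, zero_mul]

end TorsionSeries

/-! ### Divided derivatives of formal power series -/

section HasseDeriv

open PowerSeries

/-- The `i`-th divided derivative of formal power series. -/
def hasseDeriv {R : Type*} [CommSemiring R] (i : ℕ) : R⟦X⟧ →+ R⟦X⟧ where
  toFun f := mk fun k ↦ ((k + i).choose i : R) * coeff (k + i) f
  map_zero' := by ext; simp
  map_add' f g := by ext; simp [mul_add]

theorem coeff_hasseDeriv {R : Type*} [CommSemiring R] (i : ℕ) (f : R⟦X⟧) (k : ℕ) :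
    coeff k (hasseDeriv i f) = ((k + i).choose i : R) * coeff (k + i) f :=
  coeff_mk k fun k ↦ ((k + i).choose i : R) * coeff (k + i) f

theorem map_hasseDeriv {R S : Type*} [CommSemiring R] [CommSemiring S] (φ : R →+* S) (i : ℕ)
    (f : R⟦X⟧) : PowerSeries.map φ (hasseDeriv i f) = hasseDeriv i (PowerSeries.map φ f) := by
  ext k
  simp [coeff_hasseDeriv]

theorem X_pow_dvd_hasseDeriv {R : Type*} [CommSemiring R] {n i : ℕ} {f : R⟦X⟧}
    (h : X ^ (n + i) ∣ f) : X ^ n ∣ hasseDeriv i f := by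
  rw [X_pow_dvd_iff] at h ⊢
  intro m hm
  rw [coeff_hasseDeriv, h _ (Nat.add_lt_add_right hm i), mul_zero]

variable {R : Type*} [CommRing R] {p : ℕ} [CharP R p]

theorem cast_choose_add_prime_pow (hp : p.Prime) {i e : ℕ} (hi : i < p ^ e) (a : ℕ) :
    ((a + p ^ e).choose i : R) = (a.choose i : R) := by
  rw [Nat.add_choose_eq, Nat.cast_sum, Finset.sum_eq_single_of_mem (i, 0) (by simp)]
  · simp
  · rintro ⟨l, j⟩ hlj hne
    rw [Finset.HasAntidiagonal.mem_antidiagonal] at hlj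
    have hj0 : j ≠ 0 := by
      rintro rfl
      exact hne (by simp_all)
    have : p ∣ (p ^ e).choose j := hp.dvd_choose_pow hj0 (by omega)
    rw [Nat.cast_mul, (CharP.cast_eq_zero_iff R p _).2 this, mul_zero]

/-- In characteristic `p`, the divided derivatives of order less than `p ^ e` are linear over the
power series in the `p ^ e`-th power of the variable. -/
theorem hasseDeriv_X_pow_mul (hp : p.Prime) {i e : ℕ} (hi : i < p ^ e) (m : ℕ) (f : R⟦X⟧) :
    hasseDeriv i (X ^ (p ^ e * m) * f) = X ^ (p ^ e * m) * hasseDeriv i f := by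
  have h1 (f : R⟦X⟧) : hasseDeriv i (X ^ p ^ e * f) = X ^ p ^ e * hasseDeriv i f := by
    ext k
    rw [coeff_hasseDeriv, coeff_X_pow_mul', coeff_X_pow_mul']
    by_cases hk : p ^ e ≤ k
    · obtain ⟨k, rfl⟩ := Nat.exists_eq_add_of_le' hk
      rw [if_pos hk, if_pos (by omega), coeff_hasseDeriv, Nat.add_sub_cancel,
        show k + p ^ e + i - p ^ e = k + i by omega, show k + p ^ e + i = k + i + p ^ e by omega,
        cast_choose_add_prime_pow hp hi]
    · rw [if_neg hk]
      split_ifs with hki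
      · obtain ⟨a, ha⟩ := Nat.exists_eq_add_of_le' hki
        rw [ha, cast_choose_add_prime_pow hp hi, Nat.choose_eq_zero_of_lt (by omega)]
        simp
      · simp
  induction m with
  | zero => simp
  | succ m ih => rw [Nat.mul_succ, add_comm, pow_add, mul_assoc, h1, ih, mul_assoc]

end HasseDeriv

/-! ### Zariski density of the multiples of a series -/

section Density

open PowerSeries

variable {C : Type*} [Field C]

/-- Modulo `X` this is a triangular matrix whose diagonal entries are the constant coefficient of
`w`. -/
theorem isUnit_det_hasseDeriv_X_pow_mul {w : C⟦X⟧} (hw : constantCoeff w ≠ 0) (N : ℕ) :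
    IsUnit (Matrix.of fun i j : Fin N ↦ hasseDeriv (i : ℕ) (X ^ (j : ℕ) * w)).det := by
  have h0 (i j : ℕ) : constantCoeff (hasseDeriv i (X ^ j * w)) =
      if j ≤ i then coeff (i - j) w else 0 := by
    rw [← coeff_zero_eq_constantCoeff_apply, coeff_hasseDeriv, zero_add, Nat.choose_self,
      Nat.cast_one, one_mul, coeff_X_pow_mul']
  rw [PowerSeries.isUnit_iff_constantCoeff, RingHom.map_det, Matrix.det_of_isLowerTriangular]
  · refine isUnit_iff_ne_zero.2 (Finset.prod_ne_zero_iff.2 fun i _ ↦ ?_)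
    simpa [h0] using hw
  · intro i j hij
    have : ¬ (j : ℕ) ≤ i := not_le.2 hij
    simp [h0, this]

/-- A polynomial relation between the divided derivatives of `g w` that holds for all `g` with
coefficients in the prime field and nonzero constant coefficient is trivial: if `Q > N` is a power
of the characteristic, `g = ∑ X ^ j h_j` and the `h_j` are series in `X ^ Q`, then the vector of
divided derivatives of `g w` is the image of the vector of the `h_j` under an invertible matrix, and
the `h_j` can be chosen independently in an infinite set. -/
theorem eq_zero_of_forall_eval_hasseDeriv_mul (F : Type*) [Field F] [Fintype F] [Algebra F C]
    {w : C⟦X⟧} (hw : constantCoeff w ≠ 0) {N : ℕ} (P : MvPolynomial (Fin (N + 1)) C⟦X⟧)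
    (hP : ∀ g : C⟦X⟧, constantCoeff g ≠ 0 →
      PowerSeries.map (FiniteField.frobeniusAlgHom F C : C →+* C) g = g →
      MvPolynomial.eval (fun i : Fin (N + 1) ↦ hasseDeriv (i : ℕ) (g * w)) P = 0) : P = 0 := by
  obtain ⟨p, hpF⟩ := CharP.exists F
  have hp : p.Prime := (CharP.char_is_prime_or_zero F p).resolve_right
    (CharP.char_ne_zero_of_finite F p)
  have : CharP C p := charP_of_injective_algebraMap (algebraMap F C).injective p
  -- This power of `p` exceeds the order of every divided derivative involved.
  set Q := p ^ (N + 1) with hQ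
  have hNQ : N + 1 < Q := Nat.lt_pow_self hp.one_lt
  let h : ℕ → C⟦X⟧ := fun m ↦ 1 + X ^ (Q * (m + 1))
  have hinj : Function.Injective h := by
    intro m n hmn
    have hX : (X : C⟦X⟧) ^ (Q * (m + 1)) = X ^ (Q * (n + 1)) := add_left_cancel hmn
    have := congrArg (coeff (Q * (m + 1))) hX
    rw [coeff_X_pow_self, coeff_X_pow] at this
    split_ifs at this with heq
    · simpa using Nat.eq_of_mul_eq_mul_left (by omega) heq
    · exact absurd this one_ne_zero
  set M := Matrix.of fun i j : Fin (N + 1) ↦ hasseDeriv (i : ℕ) (X ^ (j : ℕ) * w) with hM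
  have hdet : IsUnit M.det := isUnit_det_hasseDeriv_X_pow_mul hw (N + 1)
  let P' := MvPolynomial.bind₁ (fun i ↦ ∑ j, MvPolynomial.C (M i j) * MvPolynomial.X j) P
  have hP' (z : Fin (N + 1) → C⟦X⟧) :
      MvPolynomial.eval z P' = MvPolynomial.eval (M.mulVec z) P := by
    have := MvPolynomial.eval₂Hom_bind₁ (RingHom.id _) z
      (fun i ↦ ∑ j, MvPolynomial.C (M i j) * MvPolynomial.X j) P
    simp only [MvPolynomial.coe_eval₂Hom] at this
    change MvPolynomial.eval₂ _ _ _ = _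
    rw [this]
    change MvPolynomial.eval _ P = _
    congr 2
    ext1 i
    simp [Matrix.mulVec, dotProduct]
  have hzero : P' = 0 := by
    refine MvPolynomial.funext_set (fun _ ↦ Set.range h)
      (fun _ ↦ Set.infinite_range_of_injective hinj) fun z hz ↦ ?_
    choose m hm using fun i ↦ hz i (Set.mem_univ i)
    rw [hP', map_zero]
    set g : C⟦X⟧ := ∑ j : Fin (N + 1), X ^ (j : ℕ) * h (m j) with hg
    have hg0 : constantCoeff g ≠ 0 := by
      have hQ0 : Q ≠ 0 := by omega
      rw [hg, map_sum, Fin.sum_univ_succ]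
      simp [h, hQ0]
    have hgF : PowerSeries.map (FiniteField.frobeniusAlgHom F C : C →+* C) g = g := by
      simp [hg, h]
    rw [← hP g hg0 hgF]
    congr 2
    ext1 i
    have hi : (i : ℕ) < p ^ (N + 1) := i.2.trans hNQ
    simp only [Matrix.mulVec, dotProduct, hM, Matrix.of_apply, hg, Finset.sum_mul, map_sum]
    refine Finset.sum_congr rfl fun j _ ↦ ?_
    rw [← hm, show X ^ (j : ℕ) * h (m j) * w = X ^ (j : ℕ) * w +
      X ^ (p ^ (N + 1) * (m j + 1)) * (X ^ (j : ℕ) * w) by simp only [h, hQ]; ring, map_add,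
      hasseDeriv_X_pow_mul hp hi]
    simp only [h, hQ]
    ring
  have : Infinite C⟦X⟧ := Infinite.of_injective h hinj
  refine MvPolynomial.funext fun v ↦ ?_
  have := hP' (M⁻¹.mulVec v)
  rw [Matrix.mulVec_mulVec, Matrix.mul_nonsing_inv _ hdet, Matrix.one_mulVec, hzero] at this
  rw [← this, map_zero, map_zero]

end Density

/-! ### Algebraic relations between divided derivatives of torsion series -/

section Relations

open PowerSeries

/-- The ring homomorphism `A[t] → S⟦t⟧` for an `A`-algebra `S`, where `A = F[θ]`. -/
def toSeries (F : Type*) [Field F] (S : Type*) [CommRing S] [Algebra F[X] S] : F[X][X] →+* S⟦X⟧ :=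
  Polynomial.coeToPowerSeries.ringHom.comp (Polynomial.mapRingHom (algebraMap F[X] S))

variable {F : Type*} [Field F]

theorem coeff_toSeries {S : Type*} [CommRing S] [Algebra F[X] S] (b : F[X][X]) (n : ℕ) :
    coeff n (toSeries F S b) = algebraMap F[X] S (b.coeff n) := by
  simp [toSeries]

theorem toSeries_injective (S : Type*) [CommRing S] [Algebra F[X] S] [FaithfulSMul F[X] S] :
    Function.Injective (toSeries F S) := by
  intro b c h
  ext1 n
  apply FaithfulSMul.algebraMap_injective F[X] S
  rw [← coeff_toSeries, ← coeff_toSeries, h]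

theorem map_comp_toSeries {S S' : Type*} [CommRing S] [Algebra F[X] S] [CommRing S']
    [Algebra F[X] S'] (φ : S →ₐ[F[X]] S') :
    (PowerSeries.map (φ : S →+* S')).comp (toSeries F S) = toSeries F S' := by
  refine RingHom.ext fun b ↦ PowerSeries.ext fun n ↦ ?_
  simp [coeff_toSeries]

theorem dvd_eval₂_sub_eval₂ {σ B R : Type*} [CommRing B] [CommRing R] (φ : B →+* R) {a b : σ → R}
    {r : R} (h : ∀ i, r ∣ a i - b i) (P : MvPolynomial σ B) :
    r ∣ MvPolynomial.eval₂ φ a P - MvPolynomial.eval₂ φ b P := by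
  rw [← Ideal.mem_span_singleton, ← Ideal.Quotient.eq, MvPolynomial.eval₂_comp_left,
    MvPolynomial.eval₂_comp_left]
  congr 1
  ext1 i
  exact Ideal.Quotient.eq.2 (Ideal.mem_span_singleton.2 (h i))

variable [Fintype F] {C : Type*} [Field C] [Algebra F C] [Algebra F[X] C]

/-- Up to order `k`, a torsion series `w` is the value at its `k`-th coefficient of a series over
`A[x]` that does not depend on `w`; hence so is each coefficient of a polynomial expression in the
divided derivatives of `w`. -/
theorem IsTorsionSeries.coeff_eval₂_hasseDeriv {w : C⟦X⟧} (hw : IsTorsionSeries F w) {N : ℕ}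
    (P : MvPolynomial (Fin N) F[X][X]) (m : ℕ) :
    coeff m (MvPolynomial.eval₂ (toSeries F C) (fun i : Fin N ↦ hasseDeriv (i : ℕ) w) P) =
      Polynomial.aeval (coeff (m + N) w) (coeff m (MvPolynomial.eval₂ (toSeries F F[X][X])
        (fun i : Fin N ↦ hasseDeriv (i : ℕ) (mk fun j ↦ carlitzIter F (m + N - j))) P)) := by
  set Θ : (F[X][X])⟦X⟧ := mk fun j ↦ carlitzIter F (m + N - j) with hΘ
  set φ : F[X][X] →ₐ[F[X]] C := Polynomial.aeval (coeff (m + N) w)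
  have hcong : X ^ (m + 1 + N) ∣ w - PowerSeries.map (φ : F[X][X] →+* C) Θ := by
    rw [X_pow_dvd_iff]
    intro j hj
    have h := hw.aeval_carlitzIter (m + N - j) j
    rw [show j + (m + N - j) = m + N by omega] at h
    rw [map_sub, coeff_map, hΘ, coeff_mk, ← h]
    exact sub_self _
  have hdvd := dvd_eval₂_sub_eval₂ (toSeries F C) (a := fun i : Fin N ↦ hasseDeriv (i : ℕ) w)
    (b := fun i : Fin N ↦ hasseDeriv (i : ℕ) (PowerSeries.map (φ : F[X][X] →+* C) Θ))
    (r := X ^ (m + 1)) (fun i ↦ by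
      rw [← map_sub]
      exact X_pow_dvd_hasseDeriv ((pow_dvd_pow _ (by omega)).trans hcong)) P
  rw [X_pow_dvd_iff] at hdvd
  have h := hdvd m m.lt_succ_self
  rw [map_sub, sub_eq_zero] at h
  rw [h]
  change _ = (φ : F[X][X] →+* C) _
  rw [← coeff_map, MvPolynomial.eval₂_comp_left, map_comp_toSeries]
  simp only [Function.comp_def, map_hasseDeriv]

variable [FaithfulSMul F[X] C]

theorem IsTorsionSeries.eval₂_hasseDeriv_eq_zero {w w' : C⟦X⟧} (hw : IsTorsionSeries F w)
    (hw' : IsTorsionSeries F w') {N : ℕ} {P : MvPolynomial (Fin N) F[X][X]}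
    (hP : MvPolynomial.eval₂ (toSeries F C) (fun i : Fin N ↦ hasseDeriv (i : ℕ) w) P = 0) :
    MvPolynomial.eval₂ (toSeries F C) (fun i : Fin N ↦ hasseDeriv (i : ℕ) w') P = 0 := by
  ext m
  rw [hw'.coeff_eval₂_hasseDeriv, map_zero]
  refine hw.aeval_eq_zero hw' ?_
  rw [← hw.coeff_eval₂_hasseDeriv, hP, map_zero]

/-- The divided derivatives of a torsion series are algebraically independent over `A[t]`. -/
theorem IsTorsionSeries.eq_zero_of_eval₂_hasseDeriv {w : C⟦X⟧} (hw : IsTorsionSeries F w) {N : ℕ}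
    {P : MvPolynomial (Fin (N + 1)) F[X][X]}
    (hP : MvPolynomial.eval₂ (toSeries F C) (fun i : Fin (N + 1) ↦ hasseDeriv (i : ℕ) w) P = 0) :
    P = 0 := by
  apply MvPolynomial.map_injective _ (toSeries_injective C)
  rw [map_zero]
  refine eq_zero_of_forall_eval_hasseDeriv_mul F hw.1 _ fun g hg0 hg ↦ ?_
  rw [MvPolynomial.eval_map]
  exact hw.eval₂_hasseDeriv_eq_zero (hw.mul hg0 hg) hP

end Relations

/-! ### Finitely generated difference fields -/

section DifferenceField

variable {E : Type*} [Field E]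

open scoped IntermediateField.algebraAdjoinAdjoin in
/-- A field generated by algebraically independent elements is algebraic over the polynomial ring in
them, being its field of fractions. -/
theorem trdeg_adjoin_range {K : Type*} [Field K] [Algebra K E] {ι : Type*} [Fintype ι] {x : ι → E}
    (hx : AlgebraicIndependent K x) :
    Algebra.trdeg K (IntermediateField.adjoin K (Set.range x)) = Fintype.card ι := by
  have h := (hx.aevalEquiv.isTranscendenceBasis
    (IsTranscendenceBasis.mvPolynomial ι K)).algebraMap_comp
    (A := IntermediateField.adjoin K (Set.range x))
  simpa using h.lift_cardinalMk_eq_trdeg.symm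

variable (σ : E →+* E) (L : Subfield E)

/-- The orbit of one element of a transformally independent set is an infinite algebraically
independent family. -/
theorem transfDeg_eq_zero {M : IntermediateField L E} (hM : ∀ x ∈ M, σ x ∈ M)
    (hfin : Algebra.trdeg L M < Cardinal.aleph0) : transfDeg σ L M = 0 := by
  refine le_antisymm (ciSup_le' fun ⟨S, hSM, hS⟩ ↦ ?_) zero_le
  rw [nonpos_iff_eq_zero, Cardinal.mk_eq_zero_iff]
  by_contra hne
  rw [not_isEmpty_iff] at hne
  obtain ⟨s⟩ := hne
  have hmem (k : ℕ) : σ^[k] (s : E) ∈ M := by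
    induction k with
    | zero => exact hSM s.2
    | succ k ih =>
      rw [Function.iterate_succ_apply']
      exact hM _ ih
  have hind : AlgebraicIndependent L fun k : ℕ ↦ (⟨σ^[k] (s : E), hmem k⟩ : M) := by
    refine AlgebraicIndependent.of_comp M.val ?_
    exact AlgebraicIndependent.comp hS (fun k ↦ (s, k)) fun a b h ↦ (Prod.mk.inj h).2
  have := hind.lift_cardinalMk_le_trdeg
  rw [Cardinal.mk_nat, Cardinal.lift_aleph0, Cardinal.aleph0_le_lift] at this
  exact absurd hfin this.not_gt

theorem map_mem_adjoin {S : Set E} (hL : ∀ x ∈ L, σ x ∈ L)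
    (hS : ∀ x ∈ S, σ x ∈ IntermediateField.adjoin L S) {x : E}
    (hx : x ∈ IntermediateField.adjoin L S) : σ x ∈ IntermediateField.adjoin L S := by
  induction hx using IntermediateField.adjoin_induction with
  | mem x hx => exact hS x hx
  | algebraMap a => exact IntermediateField.algebraMap_mem _ (⟨σ a, hL _ a.2⟩ : L)
  | add x y _ _ hx hy => rw [map_add]; exact add_mem hx hy
  | inv x _ hx => rw [map_inv₀]; exact inv_mem hx
  | mul x y _ _ hx hy => rw [map_mul]; exact mul_mem hx hy

theorem diffAdjoin_eq_adjoin {S : Set E} (hL : ∀ x ∈ L, σ x ∈ L)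
    (hS : ∀ x ∈ S, σ x ∈ IntermediateField.adjoin L S) :
    diffAdjoin σ L S = IntermediateField.adjoin L S :=
  le_antisymm
    (sInf_le ⟨IntermediateField.subset_adjoin _ _, fun _ ↦ map_mem_adjoin σ L hL hS⟩)
    (le_sInf fun _ hM ↦ IntermediateField.adjoin_le_iff.2 hM.1)

end DifferenceField

/-! ### The divided derivatives of the Anderson-Thakur function -/

section Omega

variable {F : Type*} [Field F] [Fintype F]

/-- `C_∞` as an algebra over `A = F[θ]`. -/
instance : Algebra F[X] (CInf F) := (ofA F).toAlgebra

instance : FaithfulSMul F[X] (CInf F) :=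
  (faithfulSMul_iff_algebraMap_injective _ _).2
    ((algebraMap (RatFunc F) (CInf F)).injective.comp (RatFunc.algebraMap_injective F))

theorem isTorsionSeries_omega {π : CInf F} (hπ : IsFundamentalPeriod F π) :
    IsTorsionSeries F (omega π : PowerSeries (CInf F)) := by
  refine ⟨?_, congrArg (Subring.subtype _) (tau_omega hπ)⟩
  rw [← PowerSeries.coeff_zero_eq_constantCoeff_apply, coeff_omega, zero_add, pow_one]
  exact hπ.expCInf_mul_theta_inv_ne_zero

variable (F) in
/-- The embedding of `A[t]` in the Tate algebra. -/
def toTate : F[X][X] →+* Tate F := Polynomial.eval₂RingHom (const.comp (ofA F)) (t F)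

theorem subtype_comp_toTate :
    (Subring.subtype _).comp (toTate F) = toSeries F (CInf F) := by
  refine Polynomial.ringHom_ext (fun a ↦ ?_) ?_
  · simp [toTate, toSeries]
    rfl
  · simp [toTate, toSeries]
    rfl

theorem eq_zero_of_eval₂_dividedDeriv_omega {π : CInf F} (hπ : IsFundamentalPeriod F π) {N : ℕ}
    {P : MvPolynomial (Fin (N + 1)) F[X][X]}
    (hP : MvPolynomial.eval₂ (toTate F) (fun i : Fin (N + 1) ↦ dividedDeriv i (omega π)) P = 0) :
    P = 0 := by
  refine (isTorsionSeries_omega hπ).eq_zero_of_eval₂_hasseDeriv ?_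
  have := congrArg (Subring.subtype _) hP
  rwa [MvPolynomial.eval₂_comp_left, subtype_comp_toTate, map_zero] at this

variable {E : Type*} [Field E] (ι : Tate F →+* E)

theorem map_toTate_mem_Kt (b : F[X][X]) : ι (toTate F b) ∈ Kt ι := by
  induction b using Polynomial.induction_on' with
  | add b c hb hc => rw [map_add, map_add]; exact add_mem hb hc
  | monomial n a =>
    have hC : ι (toTate F (Polynomial.C a)) ∈ Kt ι := by
      refine Subfield.subset_closure (Set.mem_insert_of_mem _ ⟨algebraMap F[X] (RatFunc F) a, ?_⟩)
      simp [toTate, ofA]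
    have hX : ι (toTate F Polynomial.X) ∈ Kt ι := by
      refine Subfield.subset_closure (Set.mem_insert_iff.2 (Or.inl ?_))
      simp [toTate]
    rw [← Polynomial.C_mul_X_pow_eq_monomial, map_mul, map_mul, map_pow, map_pow]
    exact mul_mem hC (pow_mem hX n)

/-- Independence over `A[t]` implies independence over `K(t)`, which is algebraic over `A[t]`. -/
theorem algebraicIndependent_dividedDeriv_omega {π : CInf F} (hπ : IsFundamentalPeriod F π)
    (hι : Function.Injective ι) :
    AlgebraicIndependent (Kt ι) (fun i : ℕ ↦ ι (dividedDeriv i (omega π))) := by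
  let : Algebra F[X][X] E := (ι.comp (toTate F)).toAlgebra
  let : Algebra F[X][X] (Kt ι) :=
    ((ι.comp (toTate F)).codRestrict (Kt ι) (map_toTate_mem_Kt ι)).toAlgebra
  have : IsScalarTower F[X][X] (Kt ι) E := IsScalarTower.of_algebraMap_eq fun _ ↦ rfl
  have hfin (N : ℕ) : AlgebraicIndependent F[X][X]
      (fun i : Fin (N + 1) ↦ ι (dividedDeriv i (omega π))) := by
    rw [algebraicIndependent_iff]
    intro P hP
    refine eq_zero_of_eval₂_dividedDeriv_omega hπ (hι ?_)
    rw [map_zero, MvPolynomial.eval₂_comp_left]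
    exact hP
  have hind : AlgebraicIndependent F[X][X] (fun i : ℕ ↦ ι (dividedDeriv i (omega π))) := by
    refine algebraicIndependent_of_finite_type fun s hs ↦ ?_
    obtain ⟨N, hN⟩ := hs.bddAbove
    exact (hfin N).comp (fun i : s ↦ ⟨i, Nat.lt_succ_of_le (hN i.2)⟩) fun i j h ↦
      Subtype.ext (Fin.mk.inj h)
  have halg : ∀ x ∈ Kt ι, IsAlgebraic F[X][X] x := by
    intro x hx
    induction hx using Subfield.closure_induction with
    | mem x hx =>
      rcases hx with rfl | ⟨x, rfl⟩
      · convert isAlgebraic_algebraMap (R := F[X][X]) (A := E) Polynomial.X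
        change _ = ι (toTate F Polynomial.X)
        simp [toTate]
      · obtain ⟨a, b, hb, rfl⟩ := IsFractionRing.div_surjective (A := F[X]) x
        have h (a : F[X]) : IsAlgebraic F[X][X]
            (ι (const (algebraMap (RatFunc F) (CInf F) (algebraMap F[X] (RatFunc F) a)))) := by
          convert isAlgebraic_algebraMap (R := F[X][X]) (A := E) (Polynomial.C a)
          change _ = ι (toTate F (Polynomial.C a))
          simp [toTate, ofA]
        have hcomp (x : RatFunc F) : ι (const (algebraMap (RatFunc F) (CInf F) x)) =
          ((ι.comp const).comp (algebraMap (RatFunc F) (CInf F))) x := rfl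
        beta_reduce
        rw [hcomp, map_div₀, div_eq_mul_inv]
        exact (h a).mul (h b).inv
    | one => exact isAlgebraic_one
    | add x y _ _ hx hy => exact hx.add hy
    | neg x _ hx => exact hx.neg
    | inv x _ hx => exact hx.inv
    | mul x y _ _ hx hy => exact hx.mul hy
  have : Algebra.IsAlgebraic F[X][X] (Kt ι) := ⟨fun x ↦
    (isAlgebraic_algHom_iff (IsScalarTower.toAlgHom F[X][X] (Kt ι) E) Subtype.val_injective).1
      (halg x x.2)⟩
  exact hind.extendScalars (Kt ι)

/-- The equations for `τ` show that the field generated over `K(t)` by the first divided derivatives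
of `ω` is stable under `σ`, so it is the difference field that they generate. -/
theorem independentIn_of_injective {π : CInf F} (hπ : IsFundamentalPeriod F π) (σ : E →+* E)
    (hι : Function.Injective ι) (hσ : ∀ g : Tate F, ι (tau F g) = σ (ι g)) :
    IndependentIn π σ ι := by
  have hind := algebraicIndependent_dividedDeriv_omega ι hπ hι
  refine ⟨hind, fun n ↦ ?_⟩
  have hK : ∀ x ∈ Kt ι, σ x ∈ Kt ι := by
    change Kt ι ≤ (Kt ι).comap σ
    refine Subfield.closure_le.2 ?_
    rintro _ (rfl | ⟨x, rfl⟩)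
    · refine Subfield.subset_closure (Set.mem_insert_iff.2 (Or.inl ?_))
      rw [← hσ]
      refine congrArg ι (Subtype.ext (PowerSeries.ext fun n ↦ ?_))
      rw [coeff_tau]
      by_cases hn : n = 1 <;> simp [t, PowerSeries.coeff_X, hn]
    · refine Subfield.subset_closure (Set.mem_insert_of_mem _ ⟨x ^ Fintype.card F, ?_⟩)
      rw [← hσ]
      refine congrArg ι (Subtype.ext (PowerSeries.ext fun n ↦ ?_))
      rw [coeff_tau]
      change PowerSeries.coeff n (PowerSeries.C (algebraMap (RatFunc F) (CInf F) _)) =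
        PowerSeries.coeff n (PowerSeries.C (algebraMap (RatFunc F) (CInf F) x)) ^ _
      rw [PowerSeries.coeff_C, PowerSeries.coeff_C, map_pow]
      split_ifs <;> simp
  set S : Set E := {x | ∃ i ≤ n, x = ι (dividedDeriv i (omega π))} with hS
  have hmem {i : ℕ} (hi : i ≤ n) :
      ι (dividedDeriv i (omega π)) ∈ IntermediateField.adjoin (Kt ι) S :=
    IntermediateField.subset_adjoin _ _ ⟨i, hi, rfl⟩
  have hcoef : ι (t F - const (theta F)) ∈ IntermediateField.adjoin (Kt ι) S := by
    refine IntermediateField.algebraMap_mem _ (⟨_, ?_⟩ : Kt ι)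
    have := map_toTate_mem_Kt ι (Polynomial.X - Polynomial.C Polynomial.X)
    simpa [toTate, theta] using this
  have hstable : ∀ x ∈ S, σ x ∈ IntermediateField.adjoin (Kt ι) S := by
    rintro _ ⟨i, hi, rfl⟩
    rw [← hσ]
    cases i with
    | zero =>
      rw [tau_dividedDeriv_zero_omega hπ, map_mul]
      exact mul_mem hcoef (hmem hi)
    | succ i =>
      rw [tau_dividedDeriv_succ_omega hπ, map_add, map_mul]
      exact add_mem (mul_mem hcoef (hmem hi)) (hmem (Nat.le_of_succ_le hi))
  have hrange : S = Set.range fun i : Fin (n + 1) ↦ ι (dividedDeriv i (omega π)) := by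
    ext x
    constructor
    · rintro ⟨i, hi, rfl⟩
      exact ⟨⟨i, Nat.lt_succ_of_le hi⟩, rfl⟩
    · rintro ⟨i, rfl⟩
      exact ⟨i, Nat.le_of_lt_succ i.2, rfl⟩
  have htr : Algebra.trdeg (Kt ι) (IntermediateField.adjoin (Kt ι) S) = n + 1 := by
    have h := trdeg_adjoin_range (hind.comp (fun i : Fin (n + 1) ↦ (i : ℕ)) Fin.val_injective)
    rw [hrange]
    simpa [Function.comp_def] using h
  rw [diffAdjoin_eq_adjoin σ (Kt ι) hK hstable]
  refine ⟨transfDeg_eq_zero σ (Kt ι) (fun x ↦ map_mem_adjoin σ (Kt ι) hK hstable) ?_, htr⟩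
  rw [htr]
  exact_mod_cast Cardinal.natCast_lt_aleph0 (n := n + 1)

end Omega

end Carlitz

end

theorem mainTheorem4 (F : Type*) [Field F] [Fintype F] (π : Carlitz.CInf F)
    (hπ : Carlitz.IsFundamentalPeriod F π) :
    (∀ i : ℕ, Summable (Carlitz.expTerm (Carlitz.f π i)) ∧
      Carlitz.expTate (Carlitz.f π i) = Carlitz.dividedDeriv i (Carlitz.omega π)) ∧
    Carlitz.tau F (Carlitz.dividedDeriv 0 (Carlitz.omega π)) =
      (Carlitz.t F - Carlitz.const (Carlitz.theta F)) *
        Carlitz.dividedDeriv 0 (Carlitz.omega π) ∧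
    (∀ i : ℕ, Carlitz.tau F (Carlitz.dividedDeriv (i + 1) (Carlitz.omega π)) =
      (Carlitz.t F - Carlitz.const (Carlitz.theta F)) *
        Carlitz.dividedDeriv (i + 1) (Carlitz.omega π) +
          Carlitz.dividedDeriv i (Carlitz.omega π)) ∧
    Carlitz.IndependentIn π (Carlitz.tauFrac F)
      (algebraMap (Carlitz.Tate F) (FractionRing (Carlitz.Tate F))) ∧
    ∀ ι : Carlitz.Tate F →+* Carlitz.HahnK F, Function.Injective ι →
      (∀ g : Carlitz.Tate F, ι (Carlitz.tau F g) = Carlitz.tauHahn F (ι g)) →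
      Carlitz.IndependentIn (E := Carlitz.HahnK F) π (Carlitz.tauHahn F) ι := by
  refine ⟨fun i ↦ ⟨Carlitz.summable_expTerm _, Carlitz.expTate_f π i⟩,
    Carlitz.tau_dividedDeriv_zero_omega hπ, Carlitz.tau_dividedDeriv_succ_omega hπ,
    Carlitz.independentIn_of_injective _ hπ _ (IsFractionRing.injective _ _) fun _ ↦ ?_,
    fun ι hι hσ ↦ ?_⟩
  · rw [Carlitz.tauFrac, IsFractionRing.map, IsLocalization.map_eq]
  · have h := Carlitz.independentIn_of_injective (E := Carlitz.HahnK F) ι hπ (Carlitz.tauHahn F) hι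
    exact h hσ
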